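/- Let $0\le p<1$ and $k=\lfloor 1/(1-p)\rfloor$. In the adversarial order secretary problem with $p$-sampling (AOS$p$) there are $n$ elements with distinct real values $\alpha_1,\dots,\alpha_n$ chosen by an adversary. Each element is sampled independently with probability $p$; $S$ is the set of sampled elements and $V$ the set of the remaining (online) ones. The adversary, knowing the values and $S$, chooses an order. The player, who knows $p$, first sees the values in $S$ and then the values in $V$ one by one in this order; at each of them she irrevocably either stops with it or rejects it. She wins if she stops with the largest value in $V$; if $V=\emptyset$ she wins by convention. An algorithm may be randomized, i.e. use a random seed independent of the sampling and unknown to the adversary. Its decisions may depend on the values seen so far, on the seed, and, for a player who knows $n$, also on $n$. Its success probability on size $n$ is the infimum, over the adversary's choices, of the probability of winning, and its success guarantee is the infimum of its success probabilities over all $n$. The $k$-max algorithm stops with the first online value that exceeds the $k$-th largest sampled value (taken to be $-\infty$ if there are fewer than $k$ samples); it does not use $n$. **Theorem.** For every $n$ and every choice of the adversary the $k$-max algorithm wins with probability at least $k p^k(1-p)$. For every $n>k$ its success probability is exactly $k p^k(1-p)+p^n$, where $p^n$ is the probability that $V=\emptyset$. Hence its success guarantee is exactly $k p^k(1-p)$.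 No algorithm, deterministic or randomized, has a success guarantee larger than $k p^k(1-p)$, even if the player knows $n$. The last two sentences remain true if the adversary must choose the values and the order without knowing $S$. -/

import Mathlib

open MeasureTheory

universe u

namespace AOS

/-- A possibly randomized online selection algorithm, for a player who may know the number `n` of
elements. Before the game a random seed is drawn. `accept n ω S [v₁, …, v_t]` says whether, with
seed `ω`, on an instance with `n` elements, having seen the set `S` of sampled values and having
rejected the online values `v₁, …, v_{t-1}`, the algorithm stops with the current one, `v_t`.
Deterministic algorithms are those with a one-point seed space (or with `accept` independent of
the seed); a player who does not know `n` has `accept` independent of `n`. -/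
structure Algorithm where
  Seed : Type u
  [measurableSpace : MeasurableSpace Seed]
  law : Measure Seed
  [isProbabilityMeasure : IsProbabilityMeasure law]
  accept : ℕ → Seed → Finset ℝ → List ℝ → Prop
  measurableSet_accept : ∀ n S h, MeasurableSet {ω | accept n ω S h}

attribute [instance] Algorithm.measurableSpace Algorithm.isProbabilityMeasure

/-- The player stops at position `t` (counted from `0`) of the online sequence `vs`: the first
position at which the history up to and including the current value is accepted. -/
def StopsAt (acc : List ℝ → Prop) (vs : List ℝ) (t : Fin vs.length) : Prop :=
  acc (vs.take (t + 1)) ∧ ∀ s < (t : ℕ), ¬ acc (vs.take (s + 1))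

/-- The player wins on the online sequence `vs`: she stops with its largest value. If there are
no online values she wins by convention. -/
def Wins (acc : List ℝ → Prop) (vs : List ℝ) : Prop :=
  vs = [] ∨ ∃ t : Fin vs.length, StopsAt acc vs t ∧ ∀ v ∈ vs, v ≤ vs.get t

/-- The values of the elements outside the sample set `S`, in the order `σ 0, σ 1, …`. -/
def onlineValues {n : ℕ} (α : Fin n ↪ ℝ) (σ : Equiv.Perm (Fin n)) (S : Finset (Fin n)) : List ℝ :=
  ((List.ofFn σ).filter (fun i => i ∉ S)).map α

/-- The probability that `A` wins when the `n` elements have the (distinct) values `α`, every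
element is sampled independently with probability `p`, and the order of arrival is `σ S` when `S`
is the set of sampled elements. -/
noncomputable def winProb (p : ℝ) (A : Algorithm.{u}) {n : ℕ} (α : Fin n ↪ ℝ)
    (σ : Finset (Fin n) → Equiv.Perm (Fin n)) : ℝ :=
  ∑ S : Finset (Fin n), p ^ S.card * (1 - p) ^ (n - S.card) *
    A.law.real {ω | Wins (A.accept n ω (S.map α)) (onlineValues α (σ S) S)}

/-- Success probability on `n` elements against an adversary who chooses the values and then,
knowing the set of sampled elements, the order. -/
noncomputable def successProb (p : ℝ) (A : Algorithm.{u}) (n : ℕ) : ℝ :=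
  ⨅ x : (Fin n ↪ ℝ) × (Finset (Fin n) → Equiv.Perm (Fin n)), winProb p A x.1 x.2

/-- Success guarantee: the infimum of the success probabilities over all sizes. -/
noncomputable def guarantee (p : ℝ) (A : Algorithm.{u}) : ℝ :=
  ⨅ n : ℕ, successProb p A n

/-- Success probability on `n` elements against an adversary who chooses the values and the order
without knowing the set of sampled elements. -/
noncomputable def obliviousSuccessProb (p : ℝ) (A : Algorithm.{u}) (n : ℕ) : ℝ :=
  ⨅ x : (Fin n ↪ ℝ) × Equiv.Perm (Fin n), winProb p A x.1 (fun _ => x.2)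

/-- Success guarantee against the adversary who does not know the set of sampled elements. -/
noncomputable def obliviousGuarantee (p : ℝ) (A : Algorithm.{u}) : ℝ :=
  ⨅ n : ℕ, obliviousSuccessProb p A n

/-- The `k`-th largest element (`k ≥ 1`) of a finite set of reals, `-∞` if there are fewer than `k`
elements. -/
noncomputable def kthLargest (k : ℕ) (S : Finset ℝ) : WithBot ℝ :=
  ((S.sort (· ≥ ·)).map (fun x : ℝ => (x : WithBot ℝ))).getD (k - 1) ⊥

/-- The `k`-max algorithm: stop with the first online value that exceeds the `k`-th largest
sampled value. It is deterministic and does not use `n`. -/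
noncomputable def kMax (k : ℕ) : Algorithm.{0} where
  Seed := Unit
  law := Measure.dirac ()
  accept := fun _ _ S h => ∃ v, h.getLast? = some v ∧ kthLargest k S < (v : WithBot ℝ)
  measurableSet_accept := fun _ _ _ => MeasurableSet.const _

end AOS

/-!
On a given set of samples `k`-max plays a fixed threshold. It wins whatever the order is if there
are no online values or exactly one online value above the threshold. If the online values arrive
in increasing order, it wins in no other case. When the elements are read in decreasing order, the
online values above the threshold are those before the `k`-th sampled one, and the probability that
there is exactly one of them is computed by recursion on the number of elements.

For the upper bound consider an arbitrary algorithm and an oblivious adversary.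

* On a generic increasing sequence of values, one whose entries are chosen successively along an
  ultrafilter at infinity, the probability that the algorithm rejects everything depends on the
  order of the values only.
* Let the `M` largest values arrive first, in increasing order, followed by the `T` smallest ones.
  Winning means stopping at the last online one of the `M` large values, and before that the player
  learns nothing about the small values except how many of them are sampled. The total variation
  distance between the binomial distributions of sizes `n - M` and `n` tends to `0` (Stein's
  identity and the Cauchy–Schwarz inequality). Hence for `T = n - M` and `n → ∞` the number `M` is
  hidden: in the limit there is one family `μ u` of rejection probabilities, indexed by words of
  sampled and online letters, that plays against all `M` at once. If `w'` is `w` without its last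
  online letter, then it stops at this letter with probability `μ w' - μ w`.
* Now let `M` be geometrically distributed with parameter `ρ`. The sampled letters cut the word into
  gaps. Whatever the past, the next letter is online with probability `1 - q = ρ * (1 - p)`, and the
  current gap ends with probability `q`. This is a problem of optimal stopping. By a Bellman
  inequality even a player who knows how many gaps remain wins with probability at most
  `k * q ^ k * (1 - q)`, up to the case of no online letters, and `ρ → 1` gives the theorem.
-/

namespace AOS

open Filter Topology

/-! ### Random words -/

/-- The expectation of `f W` for a random word `W` of `n` independent letters, each of them `true`
(a sampled element) with probability `p` and `false` (an online element) with probability `1 - p`.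
-/
noncomputable def wordExp (p : ℝ) (n : ℕ) (f : List Bool → ℝ) : ℝ :=
  ∑ b : Fin n → Bool, (∏ i, if b i then p else 1 - p) * f (List.ofFn b)

section WordExp

variable {p : ℝ} {n : ℕ} {f g : List Bool → ℝ}

@[simp]
theorem wordExp_zero (p : ℝ) (f : List Bool → ℝ) : wordExp p 0 f = f [] := by
  simp [wordExp]

theorem wordExp_succ (p : ℝ) (n : ℕ) (f : List Bool → ℝ) :
    wordExp p (n + 1) f =
      p * wordExp p n (fun w => f (true :: w)) + (1 - p) * wordExp p n fun w => f (false :: w) := by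
  unfold wordExp
  rw [← (Fin.consEquiv fun _ : Fin (n + 1) => Bool).sum_comp, Fintype.sum_prod_type]
  simp [Fin.consEquiv_apply, Fin.prod_univ_succ, Finset.mul_sum, mul_assoc]

@[simp]
theorem wordExp_const (p : ℝ) (n : ℕ) (c : ℝ) : wordExp p n (fun _ => c) = c := by
  induction n with
  | zero => simp
  | succ n ih => rw [wordExp_succ, ih]; ring

theorem wordExp_add (p : ℝ) (n : ℕ) (f g : List Bool → ℝ) :
    wordExp p n (fun w => f w + g w) = wordExp p n f + wordExp p n g := by
  simp only [wordExp, mul_add, Finset.sum_add_distrib]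

theorem wordExp_sub (p : ℝ) (n : ℕ) (f g : List Bool → ℝ) :
    wordExp p n (fun w => f w - g w) = wordExp p n f - wordExp p n g := by
  simp only [wordExp, mul_sub, Finset.sum_sub_distrib]

theorem wordExp_const_mul (p : ℝ) (n : ℕ) (c : ℝ) (f : List Bool → ℝ) :
    wordExp p n (fun w => c * f w) = c * wordExp p n f := by
  simp only [wordExp, Finset.mul_sum, mul_left_comm]

theorem wordExp_congr (h : ∀ w : List Bool, w.length = n → f w = g w) :
    wordExp p n f = wordExp p n g := by
  simp only [wordExp, h _ List.length_ofFn]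

theorem wordExp_mono (hp0 : 0 ≤ p) (hp1 : p ≤ 1)
    (h : ∀ w : List Bool, w.length = n → f w ≤ g w) : wordExp p n f ≤ wordExp p n g := by
  refine Finset.sum_le_sum fun b _ => mul_le_mul_of_nonneg_left (h _ List.length_ofFn) ?_
  refine Finset.prod_nonneg fun i _ => ?_
  split_ifs
  exacts [hp0, sub_nonneg.2 hp1]

theorem wordExp_mem_Icc (hp0 : 0 ≤ p) (hp1 : p ≤ 1) {a b : ℝ} (h : ∀ w, f w ∈ Set.Icc a b) :
    wordExp p n f ∈ Set.Icc a b :=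
  ⟨(wordExp_const p n a).symm.trans_le (wordExp_mono hp0 hp1 fun w _ => (h w).1),
    (wordExp_mono hp0 hp1 fun w _ => (h w).2).trans_eq (wordExp_const p n b)⟩

theorem sq_wordExp_le (hp0 : 0 ≤ p) (hp1 : p ≤ 1) (n : ℕ) (f : List Bool → ℝ) :
    wordExp p n f ^ 2 ≤ wordExp p n fun w => f w ^ 2 := by
  set c := wordExp p n f with hc
  have hvar : 0 ≤ wordExp p n fun w => (f w - c) ^ 2 := by
    simpa using wordExp_mono (f := fun _ => 0) hp0 hp1 fun w _ => sq_nonneg (f w - c)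
  have hexpand : (fun w => (f w - c) ^ 2) = fun w => f w ^ 2 - 2 * c * f w + c ^ 2 := by
    funext w; ring
  rw [hexpand, wordExp_add, wordExp_sub, wordExp_const_mul, wordExp_const, ← hc] at hvar
  linarith

theorem wordExp_append (p : ℝ) (m n : ℕ) (f : List Bool → ℝ) :
    wordExp p (m + n) f = wordExp p m fun v => wordExp p n fun w => f (v ++ w) := by
  induction m generalizing f with
  | zero => simp
  | succ m ih => rw [Nat.succ_add, wordExp_succ, wordExp_succ, ih, ih]; rfl

theorem wordExp_comm (p : ℝ) (m n : ℕ) (f : List Bool → List Bool → ℝ) :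
    (wordExp p m fun v => wordExp p n fun w => f v w) =
      wordExp p n fun w => wordExp p m fun v => f v w := by
  simp only [wordExp, Finset.mul_sum]
  rw [Finset.sum_comm]
  simp only [mul_left_comm]

theorem tendsto_wordExp {ι : Type*} {l : Filter ι} {f : ι → List Bool → ℝ}
    (h : ∀ w : List Bool, w.length = n → Tendsto (fun i => f i w) l (𝓝 (g w))) :
    Tendsto (fun i => wordExp p n (f i)) l (𝓝 (wordExp p n g)) :=
  tendsto_finsetSum _ fun _ _ => (h _ List.length_ofFn).const_mul _

theorem wordExp_ite_false_mem (p : ℝ) (n : ℕ) (f : List Bool → ℝ) :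
    (wordExp p n fun w => if false ∈ w then 0 else f w) = p ^ n * f (List.replicate n true) := by
  induction n generalizing f with
  | zero => simp
  | succ n ih =>
    have htrue := ih fun w => f (true :: w)
    simp only [wordExp_succ, List.mem_cons, Bool.false_eq_true, false_or, true_or, if_true,
      wordExp_const, htrue, List.replicate_succ]
    ring

theorem sum_finset_eq_wordExp (p : ℝ) (e : Equiv.Perm (Fin n)) (f : List Bool → ℝ) :
    ∑ S : Finset (Fin n), p ^ S.card * (1 - p) ^ (n - S.card) *
      f (List.ofFn fun i => decide (e i ∈ S)) = wordExp p n f := by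
  refine Finset.sum_bij' (fun S _ i => decide (e i ∈ S))
    (fun b _ => Finset.univ.filter fun i => b (e.symm i)) (by simp) (by simp)
    (fun S _ => by ext; simp) (fun b _ => by ext; simp) fun S _ => ?_
  have hweight : ∏ i, (if decide (e i ∈ S) = true then p else 1 - p) =
      p ^ S.card * (1 - p) ^ (n - S.card) := by
    rw [Equiv.prod_comp e fun i => if decide (i ∈ S) = true then p else 1 - p]
    simp [Finset.prod_ite, Finset.filter_not, Finset.card_sdiff_of_subset]
  rw [hweight]

end WordExp

/-! ### The `k`-max algorithm -/

/-- The rule that stops with the first value above a fixed threshold. On a given set of samples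
this is how `k`-max plays. -/
def thresholdRule (θ : WithBot ℝ) (h : List ℝ) : Prop :=
  ∃ v, h.getLast? = some v ∧ θ < (v : WithBot ℝ)

section ThresholdRule

variable {θ : WithBot ℝ} {vs : List ℝ}

theorem thresholdRule_take_succ_iff {t : ℕ} (ht : t < vs.length) :
    thresholdRule θ (vs.take (t + 1)) ↔ θ < (vs[t] : WithBot ℝ) := by
  rw [thresholdRule, List.take_succ_eq_append_getElem ht, List.getLast?_concat]
  simp

theorem wins_thresholdRule_of_existsUnique (hnodup : vs.Nodup)
    (h : ∃! v, v ∈ vs ∧ θ < (v : WithBot ℝ)) : Wins (thresholdRule θ) vs := by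
  obtain ⟨v, ⟨hv, hθv⟩, huniq⟩ := h
  obtain ⟨t, ht, rfl⟩ := List.getElem_of_mem hv
  refine Or.inr ⟨⟨t, ht⟩, ⟨(thresholdRule_take_succ_iff ht).2 hθv, fun s hs hacc => ?_⟩,
    fun x hx => ?_⟩
  · have hst : s < t := hs
    have heq := huniq _ ⟨List.getElem_mem _, (thresholdRule_take_succ_iff (hst.trans ht)).1 hacc⟩
    exact hst.ne (hnodup.getElem_inj_iff.1 heq)
  · by_contra! hlt
    exact hlt.ne' (huniq x ⟨hx, hθv.trans (WithBot.coe_lt_coe.2 hlt)⟩)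

theorem existsUnique_of_wins_thresholdRule (hvs : vs.Pairwise (· < ·)) (hne : vs ≠ [])
    (h : Wins (thresholdRule θ) vs) : ∃! v, v ∈ vs ∧ θ < (v : WithBot ℝ) := by
  obtain ⟨⟨t, ht⟩, ⟨hacc, hrej⟩, hmax⟩ := h.resolve_left hne
  refine ⟨vs[t], ⟨List.getElem_mem ht, (thresholdRule_take_succ_iff ht).1 hacc⟩, ?_⟩
  rintro y ⟨hy, hθy⟩
  obtain ⟨s, hs, rfl⟩ := List.getElem_of_mem hy
  rcases lt_trichotomy s t with hst | rfl | hts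
  · exact absurd ((thresholdRule_take_succ_iff hs).2 hθy) (hrej s hst)
  · rfl
  · exact absurd (List.pairwise_iff_getElem.1 hvs t s ht hs hts) (hmax _ hy).not_gt

end ThresholdRule

theorem getD_map_coe_lt_iff {L : List ℝ} (hL : L.Pairwise (· ≥ ·)) {v : ℝ} (hv : v ∉ L) (j : ℕ) :
    (L.map fun x : ℝ => (x : WithBot ℝ)).getD j ⊥ < (v : WithBot ℝ) ↔
      L.countP (v < ·) ≤ j := by
  induction L generalizing j with
  | nil => simp
  | cons a L ih =>
    rw [List.pairwise_cons] at hL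
    rw [List.mem_cons, not_or] at hv
    rcases lt_or_gt_of_ne hv.1 with hva | hav
    · rw [List.countP_cons_of_pos (by simpa using hva)]
      cases j with
      | zero => simpa using hva.le
      | succ j => simpa using ih hL.2 hv.2 j
    · have hcount : L.countP (v < ·) = 0 :=
        List.countP_eq_zero.2 fun x hx => by simpa using (hL.1 x hx).trans hav.le
      rw [List.countP_cons_of_neg (by simpa using hav.le), hcount]
      cases j with
      | zero => simpa using hav
      | succ j => simpa [hcount] using ih hL.2 hv.2 j

theorem kthLargest_lt_iff {k : ℕ} (hk : 1 ≤ k) {S : Finset ℝ} {v : ℝ} (hv : v ∉ S) :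
    kthLargest k S < (v : WithBot ℝ) ↔ (S.filter (v < ·)).card < k := by
  have hcount : (S.sort (· ≥ ·)).countP (v < ·) = (S.filter (v < ·)).card := by
    rw [Finset.card_def, Finset.filter_val, ← Multiset.countP_eq_card_filter,
      ← Finset.sort_eq S (· ≥ ·), Multiset.coe_countP]
  rw [kthLargest, getD_map_coe_lt_iff (Finset.pairwise_sort S _) (by simpa using hv), hcount]
  omega

section Acceptable

variable {n : ℕ} (k : ℕ) (α : Fin n ↪ ℝ) (S : Finset (Fin n))

/-- The online elements with fewer than `k` sampled elements of larger value, that is, those whose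
value exceeds the threshold of `k`-max. -/
noncomputable def acceptable : Finset (Fin n) :=
  Finset.univ.filter fun i => i ∉ S ∧ (S.filter fun j => α i < α j).card < k

variable {k α S}

theorem mem_onlineValues {σ : Equiv.Perm (Fin n)} {v : ℝ} :
    v ∈ onlineValues α σ S ↔ ∃ i, i ∉ S ∧ α i = v := by
  simp only [onlineValues, List.mem_map, List.mem_filter, List.mem_ofFn, decide_eq_true_eq]
  exact exists_congr fun i => and_congr_left fun _ => and_iff_right (σ.surjective i)

theorem onlineValues_nodup (σ : Equiv.Perm (Fin n)) : (onlineValues α σ S).Nodup :=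
  ((List.nodup_ofFn.2 σ.injective).filter _).map α.injective

theorem onlineValues_eq_nil_iff {σ : Equiv.Perm (Fin n)} :
    onlineValues α σ S = [] ↔ S = Finset.univ := by
  rw [List.eq_nil_iff_forall_not_mem, Finset.eq_univ_iff_forall]
  exact ⟨fun h i => by_contra fun hi => h _ (mem_onlineValues.2 ⟨i, hi, rfl⟩),
    fun h v hv => (mem_onlineValues.1 hv).elim fun i hi => hi.1 (h i)⟩

theorem pairwise_onlineValues (hα : StrictMono α) :
    (onlineValues α 1 S).Pairwise (· < ·) := by
  rw [onlineValues, List.pairwise_map]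
  exact List.Pairwise.filter _ (List.pairwise_ofFn.2 fun i j hij => hα hij)

theorem existsUnique_kthLargest_lt_iff (hk : 1 ≤ k) (σ : Equiv.Perm (Fin n)) :
    (∃! v, v ∈ onlineValues α σ S ∧ kthLargest k (S.map α) < (v : WithBot ℝ)) ↔
      (acceptable k α S).card = 1 := by
  have hacc (v : ℝ) : (v ∈ onlineValues α σ S ∧ kthLargest k (S.map α) < (v : WithBot ℝ)) ↔
      v ∈ (acceptable k α S).map α := by
    have hthreshold {i : Fin n} (hi : i ∉ S) :
        kthLargest k (S.map α) < (α i : WithBot ℝ) ↔ (S.filter fun j => α i < α j).card < k := by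
      rw [kthLargest_lt_iff hk (by simpa using hi), Finset.filter_map, Finset.card_map]
      rfl
    simp only [mem_onlineValues, Finset.mem_map, acceptable, Finset.mem_filter, Finset.mem_univ,
      true_and]
    constructor
    · rintro ⟨⟨i, hi, rfl⟩, hlt⟩
      exact ⟨i, ⟨hi, (hthreshold hi).1 hlt⟩, rfl⟩
    · rintro ⟨i, ⟨hi, hlt⟩, rfl⟩
      exact ⟨⟨i, hi, rfl⟩, (hthreshold hi).2 hlt⟩
  simp only [hacc, ← Finset.card_map α, Finset.card_eq_one_iff_existsUnique]

theorem wins_kMax_of_card_acceptable (hk : 1 ≤ k) (σ : Equiv.Perm (Fin n))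
    (h : S = Finset.univ ∨ (acceptable k α S).card = 1) :
    Wins (thresholdRule (kthLargest k (S.map α))) (onlineValues α σ S) :=
  h.elim (fun h => Or.inl (onlineValues_eq_nil_iff.2 h)) fun h =>
    wins_thresholdRule_of_existsUnique (onlineValues_nodup σ)
      ((existsUnique_kthLargest_lt_iff hk σ).2 h)

theorem card_acceptable_of_wins_kMax (hk : 1 ≤ k) (hα : StrictMono α)
    (h : Wins (thresholdRule (kthLargest k (S.map α))) (onlineValues α 1 S)) :
    S = Finset.univ ∨ (acceptable k α S).card = 1 :=
  or_iff_not_imp_left.2 fun hS => (existsUnique_kthLargest_lt_iff hk 1).1 <|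
    existsUnique_of_wins_thresholdRule (pairwise_onlineValues hα)
      (mt onlineValues_eq_nil_iff.1 hS) h

end Acceptable

/-- The number of online letters of a word that precede its `k`-th sampled letter. If the word
lists the elements in decreasing order of value, these are the acceptable elements. -/
def onlineBefore : ℕ → List Bool → ℕ
  | 0, _ => 0
  | _ + 1, [] => 0
  | k + 1, true :: w => onlineBefore k w
  | k + 1, false :: w => onlineBefore (k + 1) w + 1

theorem card_filter_eq_onlineBefore (k : ℕ) {n : ℕ} (b : Fin n → Bool) :
    (Finset.univ.filter fun i => b i = false ∧
      (Finset.univ.filter fun j => b j = true ∧ j < i).card < k).card =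
      onlineBefore k (List.ofFn b) := by
  induction n generalizing k with
  | zero => cases k <;> simp [onlineBefore]
  | succ n ih =>
    cases k with
    | zero => simp [onlineBefore]
    | succ k =>
      have hcard (i : Fin n) : (Finset.univ.filter fun j => b j = true ∧ j < i.succ).card =
          (if b 0 = true then 1 else 0) +
            (Finset.univ.filter fun j : Fin n => b j.succ = true ∧ j < i).card := by
        rw [Fin.card_filter_univ_succ]
        simp only [Fin.succ_pos, and_true, Fin.succ_lt_succ_iff]
        split_ifs <;> simp [add_comm]
      rw [List.ofFn_succ, Fin.card_filter_univ_succ]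
      simp only [hcard]
      cases hb : b 0
      · simp [onlineBefore, ← ih]
      · simp [onlineBefore, ← ih, add_comm 1]

theorem card_acceptable (k : ℕ) {n : ℕ} (α : Fin n ↪ ℝ) (e : Equiv.Perm (Fin n))
    (he : StrictAnti (α ∘ e)) (S : Finset (Fin n)) :
    (acceptable k α S).card = onlineBefore k (List.ofFn fun i => decide (e i ∈ S)) := by
  have hlarger (i : Fin n) : (S.filter fun j => α (e i) < α j).card =
      (Finset.univ.filter fun j => decide (e j ∈ S) = true ∧ j < i).card := by
    refine Eq.trans (congrArg _ ?_) (Finset.card_map e.toEmbedding)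
    ext j
    obtain ⟨j, rfl⟩ := e.surjective j
    simpa using fun _ => he.lt_iff_gt (a := i) (b := j)
  rw [← card_filter_eq_onlineBefore]
  refine Eq.trans (congrArg _ ?_) (Finset.card_map e.toEmbedding)
  ext i
  obtain ⟨i, rfl⟩ := e.surjective i
  simp [acceptable, hlarger]

theorem wordExp_onlineBefore_succ (p : ℝ) (n k : ℕ) (f : ℕ → ℝ) :
    (wordExp p (n + 1) fun w => f (onlineBefore (k + 1) w)) =
      p * wordExp p n (fun w => f (onlineBefore k w)) +
        (1 - p) * wordExp p n fun w => f (onlineBefore (k + 1) w + 1) :=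
  wordExp_succ _ _ _

theorem wordExp_onlineBefore_eq_zero (p : ℝ) (n k : ℕ) :
    (wordExp p n fun w => if onlineBefore k w = 0 then 1 else 0) = p ^ min n k := by
  induction n generalizing k with
  | zero => cases k <;> simp [onlineBefore]
  | succ n ih =>
    cases k with
    | zero => simp [onlineBefore]
    | succ k =>
      rw [wordExp_onlineBefore_succ p n k fun m => if m = 0 then 1 else 0, ih]
      simp [pow_succ, mul_comm]

theorem wordExp_onlineBefore_eq_one (p : ℝ) (n k : ℕ) :
    (wordExp p n fun w => if onlineBefore k w = 1 then 1 else 0) =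
      (min k n : ℕ) * p ^ min k (n - 1) * (1 - p) := by
  induction n generalizing k with
  | zero => cases k <;> simp [onlineBefore]
  | succ n ih =>
    cases k with
    | zero => simp [onlineBefore]
    | succ k =>
      rw [wordExp_onlineBefore_succ p n k fun m => if m = 1 then 1 else 0, ih]
      simp only [Nat.add_eq_right, wordExp_onlineBefore_eq_zero, Nat.add_sub_cancel]
      rcases lt_or_ge k n with hkn | hnk
      · rw [min_eq_left hkn.le, min_eq_left (Nat.le_sub_one_of_lt hkn), min_eq_right hkn,
          min_eq_left (Nat.succ_le_succ hkn.le), min_eq_left hkn]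
        push_cast; ring
      · rw [min_eq_right hnk, min_eq_right ((Nat.sub_le n 1).trans hnk),
          min_eq_left (Nat.le_succ_of_le hnk), min_eq_right (Nat.succ_le_succ hnk),
          min_eq_right (Nat.le_succ_of_le hnk)]
        rcases n with _ | n
        · simp
        · push_cast; ring

theorem exists_strictAnti_comp {n : ℕ} (α : Fin n ↪ ℝ) :
    ∃ e : Equiv.Perm (Fin n), StrictAnti (α ∘ e) := by
  refine ⟨Tuple.sort fun i => -α i, ?_⟩
  have hanti : Antitone (α ∘ Tuple.sort fun i => -α i) := fun i j hij =>
    neg_le_neg_iff.1 (Tuple.monotone_sort (fun i => -α i) hij)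
  exact hanti.strictAnti_of_injective (α.injective.comp (Equiv.injective _))

theorem sum_card_acceptable (p : ℝ) (k : ℕ) {n : ℕ} (α : Fin n ↪ ℝ) :
    ∑ S : Finset (Fin n), p ^ S.card * (1 - p) ^ (n - S.card) *
      (if S = Finset.univ ∨ (acceptable k α S).card = 1 then 1 else 0) =
      (min k n : ℕ) * p ^ min k (n - 1) * (1 - p) + p ^ n := by
  obtain ⟨e, he⟩ := exists_strictAnti_comp α
  have hall : (wordExp p n fun w => if false ∈ w then 0 else 1) = p ^ n := by
    simpa using wordExp_ite_false_mem p n fun _ => 1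
  rw [← wordExp_onlineBefore_eq_one, ← hall, ← wordExp_add, ← sum_finset_eq_wordExp p e]
  refine Finset.sum_congr rfl fun S _ => congrArg _ ?_
  have hfalse : false ∈ (List.ofFn fun i => decide (e i ∈ S)) ↔ S ≠ Finset.univ := by
    rw [Ne, Finset.eq_univ_iff_forall, e.surjective.forall]
    simp
  rw [← card_acceptable k α e he]
  simp only [hfalse]
  by_cases hS : S = Finset.univ
  · have hempty : acceptable k α S = ∅ := by simp [acceptable, hS]
    simp [hS, hS ▸ hempty]
  · simp [hS]

open Classical in
theorem winProb_kMax (p : ℝ) (k : ℕ) {n : ℕ} (α : Fin n ↪ ℝ)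
    (σ : Finset (Fin n) → Equiv.Perm (Fin n)) :
    winProb p (kMax k) α σ =
      ∑ S : Finset (Fin n), p ^ S.card * (1 - p) ^ (n - S.card) *
        if Wins (thresholdRule (kthLargest k (S.map α))) (onlineValues α (σ S) S) then 1
        else 0 := by
  refine Finset.sum_congr rfl fun S _ => congrArg _ ?_
  change (kMax k).law.real
    {_ω | Wins (thresholdRule (kthLargest k (S.map α))) (onlineValues α (σ S) S)} = _
  split_ifs with h <;> simp [h]

theorem le_winProb_kMax {p : ℝ} (hp0 : 0 ≤ p) (hp1 : p ≤ 1) {k : ℕ} (hk : 1 ≤ k) {n : ℕ}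
    (α : Fin n ↪ ℝ) (σ : Finset (Fin n) → Equiv.Perm (Fin n)) :
    (min k n : ℕ) * p ^ min k (n - 1) * (1 - p) + p ^ n ≤ winProb p (kMax k) α σ := by
  classical
  rw [winProb_kMax, ← sum_card_acceptable p k α]
  have : 0 ≤ 1 - p := sub_nonneg.2 hp1
  gcongr with S
  split_ifs with h h' h'
  · exact le_rfl
  · exact absurd (wins_kMax_of_card_acceptable hk (σ S) h) h'
  · exact zero_le_one
  · exact le_rfl

theorem winProb_kMax_of_strictMono {p : ℝ} {k : ℕ} (hk : 1 ≤ k) {n : ℕ} {α : Fin n ↪ ℝ}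
    (hα : StrictMono α) :
    winProb p (kMax k) α (fun _ => 1) = (min k n : ℕ) * p ^ min k (n - 1) * (1 - p) + p ^ n := by
  have hwins (S : Finset (Fin n)) :
      Wins (thresholdRule (kthLargest k (S.map α))) (onlineValues α 1 S) ↔
        S = Finset.univ ∨ (acceptable k α S).card = 1 :=
    ⟨card_acceptable_of_wins_kMax hk hα, wins_kMax_of_card_acceptable hk 1⟩
  simp only [winProb_kMax, hwins, ← sum_card_acceptable p k α]

theorem antitone_at_most_one_online {p : ℝ} (hp0 : 0 ≤ p) :
    Antitone fun n : ℕ => (n : ℝ) * p ^ (n - 1) * (1 - p) + p ^ n := by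
  refine antitone_nat_of_succ_le fun n => ?_
  rcases n with _ | n
  · simp
  · have hdiff : 0 ≤ p ^ n * (n + 1) * (1 - p) ^ 2 := by positivity
    simp only [Nat.add_sub_cancel]
    push_cast
    linear_combination hdiff

theorem kMax_bound_le_winProb {p : ℝ} (hp0 : 0 ≤ p) (hp1 : p ≤ 1) {k : ℕ} (hk : 1 ≤ k) {n : ℕ}
    (α : Fin n ↪ ℝ) (σ : Finset (Fin n) → Equiv.Perm (Fin n)) :
    k * p ^ k * (1 - p) ≤ winProb p (kMax k) α σ := by
  refine le_trans ?_ (le_winProb_kMax hp0 hp1 hk α σ)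
  have : 0 ≤ 1 - p := sub_nonneg.2 hp1
  rcases lt_or_ge k n with hkn | hnk
  · rw [min_eq_left hkn.le, min_eq_left (Nat.le_sub_one_of_lt hkn)]
    exact le_add_of_nonneg_right (pow_nonneg hp0 n)
  · rw [min_eq_right hnk, min_eq_right ((Nat.sub_le n 1).trans hnk)]
    calc (k : ℝ) * p ^ k * (1 - p) ≤ k * p ^ (k - 1) * (1 - p) := by
          gcongr 1; gcongr 1; exact pow_le_pow_of_le_one hp0 hp1 (Nat.sub_le _ _)
      _ ≤ k * p ^ (k - 1) * (1 - p) + p ^ k := le_add_of_nonneg_right (pow_nonneg hp0 k)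
      _ ≤ n * p ^ (n - 1) * (1 - p) + p ^ n := antitone_at_most_one_online hp0 hnk

/-! ### Optimal stopping for ordinal algorithms -/

/-- The word without its last online letter; a word without online letters is left unchanged. -/
def dropLastFalse : List Bool → List Bool
  | [] => []
  | true :: w => true :: dropLastFalse w
  | false :: w => if false ∈ w then false :: dropLastFalse w else w

theorem dropLastFalse_of_notMem {w : List Bool} (hw : false ∉ w) : dropLastFalse w = w := by
  induction w with
  | nil => rfl
  | cons b w ih =>
    cases b
    · simp at hw
    · rw [dropLastFalse, ih (by simpa using hw)]

/-- The probability that an ordinal algorithm stops exactly at the last online letter of `w`, if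
`μ u` is the probability that it rejects all online letters of `u`. It is `0` if there are none. -/
def stopGain (μ : List Bool → ℝ) (w : List Bool) : ℝ :=
  μ (dropLastFalse w) - μ w

theorem stopGain_nil (μ : List Bool → ℝ) : stopGain μ [] = 0 :=
  sub_self _

theorem stopGain_true_cons (μ : List Bool → ℝ) (w : List Bool) :
    stopGain μ (true :: w) = stopGain (fun v => μ (true :: v)) w :=
  rfl

theorem stopGain_false_cons (μ : List Bool → ℝ) (w : List Bool) :
    stopGain μ (false :: w) = stopGain (fun v => μ (false :: v)) w +
      if false ∈ w then 0 else μ w - μ (false :: w) := by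
  by_cases hw : false ∈ w
  · simp [stopGain, dropLastFalse, hw]
  · simp [stopGain, dropLastFalse, dropLastFalse_of_notMem hw, hw]

theorem wordExp_stopGain_succ (p : ℝ) (n : ℕ) (μ : List Bool → ℝ) :
    wordExp p (n + 1) (stopGain μ) =
      p * wordExp p n (stopGain fun w => μ (true :: w)) +
        (1 - p) * (wordExp p n (stopGain fun w => μ (false :: w)) +
          p ^ n * (μ (List.replicate n true) - μ (false :: List.replicate n true))) := by
  simp only [wordExp_succ, stopGain_true_cons, stopGain_false_cons, wordExp_add,
    wordExp_ite_false_mem]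

theorem sum_wordExp_stopGain_succ (p ρ : ℝ) (N : ℕ) (μ : List Bool → ℝ) :
    ∑ M ∈ Finset.range (N + 1), ρ ^ M * wordExp p M (stopGain μ) =
      ρ * p * ∑ M ∈ Finset.range N, ρ ^ M * wordExp p M (stopGain fun w => μ (true :: w)) +
        ρ * (1 - p) *
          (∑ M ∈ Finset.range N, ρ ^ M * wordExp p M (stopGain fun w => μ (false :: w)) +
            ∑ M ∈ Finset.range N, (ρ * p) ^ M *
              (μ (List.replicate M true) - μ (false :: List.replicate M true))) := by
  rw [Finset.sum_range_succ', wordExp_zero, stopGain_nil, mul_zero, add_zero,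
    ← Finset.sum_add_distrib, Finset.mul_sum, Finset.mul_sum, ← Finset.sum_add_distrib]
  refine Finset.sum_congr rfl fun M _ => ?_
  rw [wordExp_stopGain_succ]
  ring

/-- An upper bound for the probability of stopping at the last online letter when `m` gaps between
sampled letters remain and every gap ends before its next online letter with probability `q`. It is
attained by accepting the first online letter of the last `k` gaps. -/
def gapValue (k : ℕ) (q : ℝ) (m : ℕ) : ℝ :=
  (min m k : ℕ) * q ^ min m k * (1 - q)

section OptimalStopping

variable {k : ℕ} {q : ℝ}

theorem gapValue_nonneg (hq0 : 0 ≤ q) (hq1 : q ≤ 1) (m : ℕ) : 0 ≤ gapValue k q m :=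
  mul_nonneg (mul_nonneg (Nat.cast_nonneg _) (pow_nonneg hq0 _)) (sub_nonneg.2 hq1)

theorem gapValue_le_succ (hq0 : 0 ≤ q) (hq1 : q ≤ 1) (hkq : k * (1 - q) ≤ 1) (m : ℕ) :
    gapValue k q m ≤ gapValue k q (m + 1) := by
  have : 0 ≤ 1 - q := sub_nonneg.2 hq1
  unfold gapValue
  rcases lt_or_ge m k with hmk | hkm
  · have hm : ((m + 1 : ℕ) : ℝ) * (1 - q) ≤ 1 := hkq.trans' (by gcongr; exact hmk)
    have hmq : (m : ℝ) ≤ (m + 1 : ℕ) * q := by push_cast at hm ⊢; linarith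
    rw [min_eq_left hmk.le, min_eq_left (Nat.succ_le_of_lt hmk)]
    calc (m : ℝ) * q ^ m * (1 - q) ≤ ((m + 1 : ℕ) * q) * q ^ m * (1 - q) := by gcongr
      _ = (m + 1 : ℕ) * q ^ (m + 1) * (1 - q) := by ring
  · rw [min_eq_right hkm, min_eq_right (Nat.le_succ_of_le hkm)]

theorem gapValue_le (hq0 : 0 ≤ q) (hq1 : q ≤ 1) (hkq : k * (1 - q) ≤ 1) (m : ℕ) :
    gapValue k q m ≤ k * q ^ k * (1 - q) := by
  simpa [gapValue] using
    monotone_nat_of_le_succ (gapValue_le_succ hq0 hq1 hkq) (le_max_left m k)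

/-- The Bellman inequality: `Q` and `Q'` are the probabilities of still playing before and after
an online letter in the first of `m + 1` gaps. -/
theorem gapValue_step (hq0 : 0 ≤ q) (hq1 : q ≤ 1) (hkq : k * (1 - q) ≤ 1)
    (hkq' : 1 ≤ (k + 1) * (1 - q)) (m : ℕ) {Q Q' : ℝ} (hQ' : 0 ≤ Q') (hQ : Q' ≤ Q) :
    q * Q * gapValue k q m + (1 - q) * (Q' * gapValue k q (m + 1) + (Q - Q') * q ^ (m + 1)) ≤
      Q * gapValue k q (m + 1) := by
  have h1q : 0 ≤ 1 - q := sub_nonneg.2 hq1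
  rcases lt_or_ge m k with hmk | hkm
  · have hm : ((m + 1 : ℕ) : ℝ) * (1 - q) ≤ 1 := hkq.trans' (by gcongr; exact hmk)
    have hslack : 0 ≤ (1 - q) * Q' * (q ^ (m + 1) * (1 - (m + 1 : ℕ) * (1 - q))) :=
      mul_nonneg (mul_nonneg h1q hQ') (mul_nonneg (pow_nonneg hq0 _) (sub_nonneg.2 hm))
    rw [gapValue, gapValue, min_eq_left hmk.le, min_eq_left (by omega : m + 1 ≤ k)]
    push_cast at hslack ⊢
    linear_combination hslack
  · have hpow : q ^ (m + 1) ≤ k * q ^ k * (1 - q) :=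
      calc q ^ (m + 1) ≤ q ^ (k + 1) := pow_le_pow_of_le_one hq0 hq1 (Nat.succ_le_succ hkm)
        _ = q ^ k * q := pow_succ _ _
        _ ≤ q ^ k * (k * (1 - q)) := by gcongr; linarith
        _ = k * q ^ k * (1 - q) := by ring
    have hslack : 0 ≤ (1 - q) * (Q - Q') * (k * q ^ k * (1 - q) - q ^ (m + 1)) :=
      mul_nonneg (mul_nonneg h1q (sub_nonneg.2 hQ)) (sub_nonneg.2 hpow)
    rw [gapValue, gapValue, min_eq_right hkm, min_eq_right (Nat.le_succ_of_le hkm)]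
    linear_combination hslack

theorem sum_gapValue_step {x : ℝ} (hq0 : 0 ≤ q) (hq1 : q ≤ 1) (hx : 0 ≤ x)
    (hkq : k * (1 - q) ≤ 1) (hkq' : 1 ≤ (k + 1) * (1 - q)) {Q Q' : ℕ → ℝ} (hQ' : ∀ m, 0 ≤ Q' m)
    (hQ : ∀ m, Q' m ≤ Q m) (N : ℕ) :
    x * q * ∑ m ∈ Finset.range N, x ^ m * (Q (m + 1) * gapValue k q (m + 1)) +
        (1 - q) * ∑ m ∈ Finset.range N,
          x ^ m * (Q' m * gapValue k q (m + 1) + (Q m - Q' m) * q ^ (m + 1)) ≤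
      ∑ m ∈ Finset.range (N + 1), x ^ m * (Q m * gapValue k q (m + 1)) := by
  have : 0 ≤ 1 - q := sub_nonneg.2 hq1
  have hlast : 0 ≤ x ^ N * (Q' N * gapValue k q (N + 1) + (Q N - Q' N) * q ^ (N + 1)) :=
    mul_nonneg (pow_nonneg hx _) (add_nonneg (mul_nonneg (hQ' N) (gapValue_nonneg hq0 hq1 _))
      (mul_nonneg (sub_nonneg.2 (hQ N)) (pow_nonneg hq0 _)))
  have hshift : x * q * ∑ m ∈ Finset.range N, x ^ m * (Q (m + 1) * gapValue k q (m + 1)) =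
      ∑ m ∈ Finset.range (N + 1), x ^ m * (q * Q m * gapValue k q m) := by
    rw [Finset.sum_range_succ', Finset.mul_sum]
    simp only [gapValue, Nat.zero_min, Nat.cast_zero, zero_mul, mul_zero, add_zero]
    exact Finset.sum_congr rfl fun m _ => by ring
  calc _ ≤ ∑ m ∈ Finset.range (N + 1), x ^ m * (q * Q m * gapValue k q m) +
          (1 - q) * ∑ m ∈ Finset.range (N + 1),
            x ^ m * (Q' m * gapValue k q (m + 1) + (Q m - Q' m) * q ^ (m + 1)) := by
        rw [hshift, Finset.sum_range_succ (fun m => x ^ m * (Q' m * _ + _))]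
        gcongr
        exact le_add_of_nonneg_right hlast
    _ = ∑ m ∈ Finset.range (N + 1), x ^ m * (q * Q m * gapValue k q m +
          (1 - q) * (Q' m * gapValue k q (m + 1) + (Q m - Q' m) * q ^ (m + 1))) := by
        rw [Finset.mul_sum, ← Finset.sum_add_distrib]
        exact Finset.sum_congr rfl fun m _ => by ring
    _ ≤ _ := Finset.sum_le_sum fun m _ => mul_le_mul_of_nonneg_left
        (gapValue_step hq0 hq1 hkq hkq' m (hQ' m) (hQ m)) (pow_nonneg hx m)

/-- Words of all lengths `M`, weighted with `ρ ^ M`, are treated together: their next letter is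
sampled with weight `ρ * p = x * q` and online with weight `ρ * (1 - p) = 1 - q`, whatever their
length is. -/
theorem sum_wordExp_stopGain_le {p ρ x : ℝ} (hq0 : 0 ≤ q) (hq1 : q ≤ 1) (hx : 0 ≤ x)
    (hkq : k * (1 - q) ≤ 1) (hkq' : 1 ≤ (k + 1) * (1 - q))
    (hsampled : ρ * p = x * q) (honline : ρ * (1 - p) = 1 - q) {μ : List Bool → ℝ}
    (hμ0 : ∀ w, 0 ≤ μ w) (hμ : ∀ w, μ w ≤ μ (dropLastFalse w)) (N : ℕ) :
    q * ∑ M ∈ Finset.range N, ρ ^ M * wordExp p M (stopGain μ) ≤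
      ∑ m ∈ Finset.range N, x ^ m * (μ (List.replicate m true) * gapValue k q (m + 1)) := by
  induction N generalizing μ with
  | zero => simp
  | succ N ih =>
    set Q : ℕ → ℝ := fun m => μ (List.replicate m true)
    set Q' : ℕ → ℝ := fun m => μ (false :: List.replicate m true)
    set D := fun ν => ∑ M ∈ Finset.range N, ρ ^ M * wordExp p M (stopGain ν)
    have hQ (m : ℕ) : Q' m ≤ Q m := by
      simpa [dropLastFalse] using hμ (false :: List.replicate m true)
    have htrue : q * D (fun w => μ (true :: w)) ≤
        ∑ m ∈ Finset.range N, x ^ m * (Q (m + 1) * gapValue k q (m + 1)) :=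
      ih (fun w => hμ0 (true :: w)) fun w => hμ (true :: w)
    have hfalse : q * D (fun w => μ (false :: w)) ≤
        ∑ m ∈ Finset.range N, x ^ m * (Q' m * gapValue k q (m + 1)) := by
      refine ih (fun w => hμ0 (false :: w)) fun w => ?_
      by_cases hw : false ∈ w
      · simpa [dropLastFalse, hw] using hμ (false :: w)
      · rw [dropLastFalse_of_notMem hw]
    have hgain : q * ∑ m ∈ Finset.range N, (ρ * p) ^ m * (Q m - Q' m) =
        ∑ m ∈ Finset.range N, x ^ m * ((Q m - Q' m) * q ^ (m + 1)) := by
      rw [hsampled, Finset.mul_sum]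
      exact Finset.sum_congr rfl fun m _ => by rw [mul_pow]; ring
    have h1q : 0 ≤ 1 - q := sub_nonneg.2 hq1
    refine le_trans ?_ (sum_gapValue_step hq0 hq1 hx hkq hkq' (fun m => hμ0 _) hQ N)
    calc _ = x * q * (q * D fun w => μ (true :: w)) +
          (1 - q) * (q * D (fun w => μ (false :: w)) +
            q * ∑ m ∈ Finset.range N, (ρ * p) ^ m * (Q m - Q' m)) := by
          rw [sum_wordExp_stopGain_succ, honline, ← hsampled]
          ring
      _ ≤ _ := by
          rw [hgain]
          simp only [mul_add, Finset.sum_add_distrib] at htrue hfalse ⊢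
          have := mul_le_mul_of_nonneg_left htrue (mul_nonneg hx hq0)
          have := mul_le_mul_of_nonneg_left hfalse h1q
          linarith

/-- If the length of the word is geometric with parameter `ρ`, then `q` is the probability that the
next letter is not an online one: it is sampled, or the word has ended. -/
theorem discounted_wordExp_stopGain_le {p ρ : ℝ} (hp0 : 0 ≤ p) (hp1 : p ≤ 1) (hρ0 : 0 ≤ ρ)
    (hρ1 : ρ < 1) (hq : q = 1 - ρ * (1 - p)) (hkq : k * (1 - q) ≤ 1) (hkq' : 1 ≤ (k + 1) * (1 - q))
    {μ : List Bool → ℝ} (hμ01 : ∀ w, μ w ∈ Set.Icc 0 1) (hμ : ∀ w, μ w ≤ μ (dropLastFalse w))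
    (N : ℕ) :
    (1 - ρ) * ∑ M ∈ Finset.range N, ρ ^ M * wordExp p M (stopGain μ) ≤ k * q ^ k * (1 - q) := by
  have hq0 : 0 < q := by linarith [mul_nonneg hρ0 hp0]
  have hq1 : q ≤ 1 := by linarith [mul_nonneg hρ0 (sub_nonneg.2 hp1)]
  set x := ρ * p / q
  have hxq : ρ * p = x * q := (div_mul_cancel₀ _ hq0.ne').symm
  have hx0 : 0 ≤ x := by positivity
  have hx1 : (1 - x) * q = 1 - ρ := by rw [sub_mul, ← hxq, hq]; ring
  have h1x : 0 ≤ 1 - x := nonneg_of_mul_nonneg_left (hx1 ▸ sub_nonneg.2 hρ1.le) hq0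
  have hK : 0 ≤ k * q ^ k * (1 - q) :=
    mul_nonneg (mul_nonneg k.cast_nonneg (pow_nonneg hq0.le k)) (sub_nonneg.2 hq1)
  calc _ = (1 - x) * (q * ∑ M ∈ Finset.range N, ρ ^ M * wordExp p M (stopGain μ)) := by
        rw [← hx1]; ring
    _ ≤ (1 - x) * ∑ m ∈ Finset.range N,
          x ^ m * (μ (List.replicate m true) * gapValue k q (m + 1)) := by
        gcongr
        exact sum_wordExp_stopGain_le hq0.le hq1 hx0 hkq hkq' hxq (by rw [hq]; ring)
          (fun w => (hμ01 w).1) hμ N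
    _ ≤ (1 - x) * ∑ m ∈ Finset.range N, x ^ m * (k * q ^ k * (1 - q)) := by
        refine mul_le_mul_of_nonneg_left (Finset.sum_le_sum fun m _ => ?_) h1x
        exact mul_le_mul_of_nonneg_left ((mul_le_of_le_one_left (gapValue_nonneg hq0.le hq1 _)
          (hμ01 _).2).trans (gapValue_le hq0.le hq1 hkq _)) (pow_nonneg hx0 m)
    _ = (1 - x ^ N) * (k * q ^ k * (1 - q)) := by
        rw [← Finset.sum_mul, ← mul_assoc, mul_neg_geom_sum]
    _ ≤ k * q ^ k * (1 - q) :=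
        mul_le_of_le_one_left hK (sub_le_self _ (pow_nonneg hx0 N))

end OptimalStopping

theorem le_of_discounted_sum_le {ρ c K : ℝ} (hρ0 : 0 ≤ ρ) (hρ1 : ρ < 1) {a : ℕ → ℝ}
    (ha : ∀ M, c ≤ a M) (hK : ∀ N, (1 - ρ) * ∑ M ∈ Finset.range N, ρ ^ M * a M ≤ K) : c ≤ K := by
  have hpartial (N : ℕ) : (1 - ρ ^ N) * c ≤ K := by
    refine le_trans ?_ (hK N)
    have : 0 ≤ 1 - ρ := sub_nonneg.2 hρ1.le
    rw [← mul_neg_geom_sum, mul_assoc, Finset.sum_mul]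
    gcongr with M
    exact ha M
  have hlim : Tendsto (fun N => (1 - ρ ^ N) * c) atTop (𝓝 ((1 - 0) * c)) :=
    ((tendsto_pow_atTop_nhds_zero_of_lt_one hρ0 hρ1).const_sub 1).mul_const c
  simpa using le_of_tendsto' hlim hpartial

theorem le_of_forall_le_wordExp_stopGain {p : ℝ} (hp0 : 0 ≤ p) (hp1 : p < 1) {k : ℕ}
    (hkp : k * (1 - p) ≤ 1) (hkp' : 1 < (k + 1) * (1 - p)) {μ : List Bool → ℝ}
    (hμ01 : ∀ w, μ w ∈ Set.Icc 0 1) (hμ : ∀ w, μ w ≤ μ (dropLastFalse w)) {c : ℝ}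
    (hc : ∀ M, c ≤ wordExp p M (stopGain μ) + p ^ M) : c ≤ k * p ^ k * (1 - p) := by
  have hp : 0 < 1 - p := sub_pos.2 hp1
  have hdiscounted {ρ : ℝ} (hρ0 : 0 ≤ ρ) (hρ1 : ρ < 1) (hkρ : 1 ≤ (k + 1) * (ρ * (1 - p))) :
      c ≤ k * (1 - ρ * (1 - p)) ^ k * (ρ * (1 - p)) + (1 - ρ) / (1 - p) := by
    refine le_of_discounted_sum_le hρ0 hρ1 hc fun N => ?_
    have hkρ' : k * (ρ * (1 - p)) ≤ 1 := hkp.trans' <| by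
      gcongr
      exact mul_le_of_le_one_left hp.le hρ1.le
    have hgain := discounted_wordExp_stopGain_le (k := k) hp0 hp1.le hρ0 hρ1 rfl
      (by simpa using hkρ') (by simpa using hkρ) hμ01 hμ N
    have hall : ∑ M ∈ Finset.range N, ρ ^ M * p ^ M ≤ 1 / (1 - p) := by
      rw [le_div_iff₀' hp]
      calc (1 - p) * ∑ M ∈ Finset.range N, ρ ^ M * p ^ M
          ≤ (1 - p) * ∑ M ∈ Finset.range N, p ^ M := by
            gcongr with M
            exact mul_le_of_le_one_left (pow_nonneg hp0 M) (pow_le_one₀ hρ0 hρ1.le)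
        _ = 1 - p ^ N := mul_neg_geom_sum p N
        _ ≤ 1 := sub_le_self _ (pow_nonneg hp0 N)
    rw [sub_sub_cancel] at hgain
    simp only [mul_add, Finset.sum_add_distrib]
    refine add_le_add hgain ?_
    rw [div_eq_mul_one_div]
    exact mul_le_mul_of_nonneg_left hall (sub_nonneg.2 hρ1.le)
  have hbound : Tendsto (fun ρ : ℝ => k * (1 - ρ * (1 - p)) ^ k * (ρ * (1 - p)) +
      (1 - ρ) / (1 - p)) (𝓝[<] 1) (𝓝 (k * p ^ k * (1 - p))) := by
    refine Tendsto.mono_left (Continuous.tendsto' (by fun_prop) _ _ ?_) nhdsWithin_le_nhds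
    simp
  have hlarge : ∀ᶠ ρ : ℝ in 𝓝[<] 1, 1 < (k + 1) * (ρ * (1 - p)) :=
    nhdsWithin_le_nhds <|
      (Continuous.tendsto' (by fun_prop) 1 _ (by rw [one_mul])).eventually_const_lt hkp'
  refine ge_of_tendsto hbound ?_
  filter_upwards [hlarge, self_mem_nhdsWithin, nhdsWithin_le_nhds (Ioi_mem_nhds one_pos)] with
    ρ hkρ hρ1 hρ0
  exact hdiscounted (le_of_lt hρ0) hρ1 hkρ.le

/-! ### Binomial distributions with close parameters -/

/-- The expectation of `f X`, where `X` has the binomial distribution with parameters `n` and `p`.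
-/
noncomputable def binomExp (p : ℝ) (n : ℕ) (f : ℕ → ℝ) : ℝ :=
  wordExp p n fun t => f (t.count true)

section BinomExp

variable {p : ℝ} {f : ℕ → ℝ}

@[simp]
theorem binomExp_zero (p : ℝ) (f : ℕ → ℝ) : binomExp p 0 f = f 0 := by
  simp [binomExp]

theorem binomExp_succ (p : ℝ) (n : ℕ) (f : ℕ → ℝ) :
    binomExp p (n + 1) f =
      p * binomExp p n (fun a => f (a + 1)) + (1 - p) * binomExp p n f := by
  simp [binomExp, wordExp_succ]

theorem binomExp_stein (p : ℝ) (n : ℕ) (f : ℕ → ℝ) :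
    binomExp p (n + 1) (fun a => (a - (n + 1) * p) * f a) =
      (n + 1) * p * (1 - p) * (binomExp p n (fun a => f (a + 1)) - binomExp p n f) := by
  induction n generalizing f with
  | zero => simp only [binomExp_succ, binomExp_zero]; push_cast; ring
  | succ n ih =>
    have hsampled : (fun a : ℕ => (((a + 1 : ℕ) : ℝ) - ((n + 1 : ℕ) + 1) * p) * f (a + 1)) =
        fun a : ℕ => (a - (n + 1) * p) * f (a + 1) + (1 - p) * f (a + 1) := by
      funext a; push_cast; ring
    have honline : (fun a : ℕ => ((a : ℝ) - ((n + 1 : ℕ) + 1) * p) * f a) =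
        fun a : ℕ => (a - (n + 1) * p) * f a - p * f a := by
      funext a; push_cast; ring
    have hadd (g h : ℕ → ℝ) : binomExp p (n + 1) (fun a => g a + h a) =
      binomExp p (n + 1) g + binomExp p (n + 1) h := wordExp_add ..
    have hsub (g h : ℕ → ℝ) : binomExp p (n + 1) (fun a => g a - h a) =
      binomExp p (n + 1) g - binomExp p (n + 1) h := wordExp_sub ..
    have hmul (c : ℝ) (g : ℕ → ℝ) : binomExp p (n + 1) (fun a => c * g a) =
      c * binomExp p (n + 1) g := wordExp_const_mul ..
    rw [binomExp_succ, hsampled, honline, hadd, hsub, ih f, ih (fun a => f (a + 1)), hmul, hmul,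
      binomExp_succ p n f, binomExp_succ p n fun a => f (a + 1)]
    push_cast
    ring

theorem binomExp_variance (p : ℝ) (n : ℕ) :
    binomExp p (n + 1) (fun a => (a - (n + 1) * p) ^ 2) = (n + 1) * p * (1 - p) := by
  have hshift : binomExp p n (fun a => ((a + 1 : ℕ) : ℝ) - (n + 1) * p) =
      1 + binomExp p n (fun a => (a : ℝ) - (n + 1) * p) := by
    rw [binomExp, binomExp, ← wordExp_const p n 1, ← wordExp_add, wordExp_const]
    refine wordExp_congr fun t _ => ?_
    push_cast
    ring
  simp only [pow_two]
  rw [binomExp_stein, hshift]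
  ring

theorem abs_binomExp_sub_mul_le (hp0 : 0 ≤ p) (hp1 : p ≤ 1) (n : ℕ)
    (hf : ∀ a, f a ∈ Set.Icc 0 1) :
    |binomExp p (n + 1) (fun a => (a - (n + 1) * p) * f a)| ≤ √(n + 1) := by
  refine Real.abs_le_sqrt ((sq_wordExp_le hp0 hp1 _ _).trans ?_)
  calc binomExp p (n + 1) (fun a => ((a - (n + 1) * p) * f a) ^ 2)
      ≤ binomExp p (n + 1) (fun a => (a - (n + 1) * p) ^ 2) := by
        refine wordExp_mono hp0 hp1 fun t _ => ?_
        beta_reduce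
        rw [mul_pow]
        exact mul_le_of_le_one_right (sq_nonneg _) (pow_le_one₀ (hf _).1 (hf _).2)
    _ = (n + 1) * (p * (1 - p)) := by rw [binomExp_variance, mul_assoc]
    _ ≤ n + 1 := mul_le_of_le_one_right (by positivity) (by nlinarith)

theorem abs_binomExp_succ_sub_le (hp0 : 0 ≤ p) (hp1 : p < 1) (n : ℕ)
    (hf : ∀ a, f a ∈ Set.Icc 0 1) :
    |binomExp p (n + 1) f - binomExp p n f| ≤ 1 / ((1 - p) * √(n + 1)) := by
  have : 0 < 1 - p := sub_pos.2 hp1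
  have hsqrt : √((n : ℝ) + 1) * √(n + 1) = n + 1 := Real.mul_self_sqrt (by positivity)
  have hstein : binomExp p (n + 1) (fun a => (a - (n + 1) * p) * f a) =
      (1 - p) * (√(n + 1) * √(n + 1)) * (binomExp p (n + 1) f - binomExp p n f) := by
    rw [binomExp_stein, binomExp_succ, hsqrt]
    ring
  have hbound := abs_binomExp_sub_mul_le hp0 hp1.le n hf
  rw [hstein, abs_mul, abs_of_pos (by positivity)] at hbound
  rw [le_div_iff₀ (by positivity)]
  refine le_of_mul_le_mul_right ?_ (show 0 < √((n : ℝ) + 1) by positivity)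
  linarith

theorem abs_binomExp_add_sub_le (hp0 : 0 ≤ p) (hp1 : p < 1) (T M : ℕ)
    (hf : ∀ a, f a ∈ Set.Icc 0 1) :
    |binomExp p (T + M) f - binomExp p T f| ≤ M * (1 / ((1 - p) * √(T + 1))) := by
  have : 0 < 1 - p := sub_pos.2 hp1
  induction M with
  | zero => simp
  | succ M ih =>
    calc |binomExp p (T + (M + 1)) f - binomExp p T f|
        ≤ |binomExp p (T + M + 1) f - binomExp p (T + M) f| +
            |binomExp p (T + M) f - binomExp p T f| := abs_sub_le _ _ _
      _ ≤ 1 / ((1 - p) * √((T + M : ℕ) + 1)) + M * (1 / ((1 - p) * √(T + 1))) :=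
          add_le_add (abs_binomExp_succ_sub_le hp0 hp1 _ hf) ih
      _ ≤ 1 / ((1 - p) * √(T + 1)) + M * (1 / ((1 - p) * √(T + 1))) := by
          gcongr
          exact Nat.le_add_right T M
      _ = (M + 1 : ℕ) * (1 / ((1 - p) * √(T + 1))) := by push_cast; ring

theorem tendsto_binomExp_sub (hp0 : 0 ≤ p) (hp1 : p < 1) (M : ℕ) {f : ℕ → ℕ → ℝ}
    (hf : ∀ n a, f n a ∈ Set.Icc 0 1) :
    Tendsto (fun n => binomExp p (n - M) (f n) - binomExp p n (f n)) atTop (𝓝 0) := by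
  rw [← tendsto_add_atTop_iff_nat M]
  refine squeeze_zero_norm (a := fun T : ℕ => M * (1 / ((1 - p) * √((T : ℝ) + 1)))) ?_ ?_
  · intro T
    rw [Nat.add_sub_cancel, Real.norm_eq_abs, abs_sub_comm]
    exact abs_binomExp_add_sub_le hp0 hp1 T M (hf _)
  · have hsqrt : Tendsto (fun T : ℕ => √((T : ℝ) + 1)) atTop atTop :=
      Real.tendsto_sqrt_atTop.comp
        (tendsto_atTop_add_const_right _ _ tendsto_natCast_atTop_atTop)
    simpa using (hsqrt.const_mul_atTop (sub_pos.2 hp1)).inv_tendsto_atTop.const_mul (M : ℝ)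

end BinomExp

/-! ### Generic increasing sequences -/

/-- The ultrafilter of generic increasing lists of length `n`: each entry is arbitrarily large, and
the later ones are arbitrarily large in comparison with the earlier ones. It replaces Ramsey's
theorem: what an algorithm does on a generic list depends on the order of the values only. -/
noncomputable def genericList : ℕ → Ultrafilter (List ℝ)
  | 0 => pure []
  | n + 1 => (Ultrafilter.of (atTop : Filter ℝ)).bind fun x => (genericList n).map (x :: ·)

theorem eventually_genericList_succ {n : ℕ} {P : List ℝ → Prop} :
    (∀ᶠ l in genericList (n + 1), P l) ↔
      ∀ᶠ x in Ultrafilter.of (atTop : Filter ℝ), ∀ᶠ l in genericList n, P (x :: l) :=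
  Iff.rfl

theorem eventually_genericList_length (n : ℕ) : ∀ᶠ l : List ℝ in genericList n, l.length = n := by
  induction n with
  | zero => exact rfl
  | succ n ih =>
    rw [eventually_genericList_succ]
    exact Eventually.of_forall fun x => ih.mono fun l hl => by simp [hl]

theorem eventually_genericList_gt (n : ℕ) (a : ℝ) :
    ∀ᶠ l : List ℝ in genericList n, ∀ y ∈ l, a < y := by
  induction n with
  | zero => exact fun y hy => absurd hy List.not_mem_nil
  | succ n ih =>
    rw [eventually_genericList_succ]
    have hgt : ∀ᶠ x in Ultrafilter.of (atTop : Filter ℝ), a < x :=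
      Ultrafilter.of_le _ (eventually_gt_atTop a)
    exact hgt.mono fun x hx => ih.mono fun l hl => List.forall_mem_cons.2 ⟨hx, hl⟩

theorem eventually_genericList_sorted (n : ℕ) :
    ∀ᶠ l : List ℝ in genericList n, l.Pairwise (· < ·) := by
  induction n with
  | zero => exact List.Pairwise.nil
  | succ n ih =>
    rw [eventually_genericList_succ]
    exact Eventually.of_forall fun x => (ih.and (eventually_genericList_gt n x)).mono
      fun l hl => List.pairwise_cons.2 ⟨hl.2, hl.1⟩

section Select

variable {κ β : Type*} [DecidableEq κ]

/-- The entries of `l` whose position is labelled `a` by `c`. -/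
def select (a : κ) (c : List κ) (l : List β) : List β :=
  ((c.zip l).filter fun x => x.1 = a).map Prod.snd

@[simp]
theorem select_cons_cons (a b : κ) (c : List κ) (x : β) (l : List β) :
    select a (b :: c) (x :: l) = if b = a then x :: select a c l else select a c l := by
  by_cases h : b = a <;> simp [select, h]

theorem select_append (a : κ) {c₁ c₂ : List κ} {l₁ l₂ : List β} (h : c₁.length = l₁.length) :
    select a (c₁ ++ c₂) (l₁ ++ l₂) = select a c₁ l₁ ++ select a c₂ l₂ := by
  rw [select, List.zip_append h, List.filter_append, List.map_append]
  rfl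

theorem select_map_map {ι : Type*} (a : κ) (b : ι → κ) (f : ι → β) (L : List ι) :
    select a (L.map b) (L.map f) = (L.filter fun i => b i = a).map f := by
  rw [select, List.zip_map', List.filter_map, List.map_map]
  rfl

theorem select_map_label {ν : Type*} [DecidableEq ν] {g : κ → ν} {a : κ} {a' : ν}
    (hg : ∀ b, g b = a' ↔ b = a) (c : List κ) (l : List β) :
    select a' (c.map g) l = select a c l := by
  simp [select, List.zip_map_left, List.filter_map, Function.comp_def, hg]

theorem length_select (a : κ) {c : List κ} {l : List β} (h : c.length = l.length) :
    (select a c l).length = c.count a := by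
  rw [select, List.length_map, ← List.countP_eq_length_filter]
  conv_rhs => rw [← List.map_fst_zip h.le, List.count, List.countP_map]
  rfl

theorem select_eq_nil_iff {a : κ} {c : List κ} {l : List β} (h : c.length = l.length) :
    select a c l = [] ↔ a ∉ c := by
  rw [← List.length_eq_zero_iff, length_select a h, List.count_eq_zero]

theorem select_sublist (a : κ) (c : List κ) (l : List β) : (select a c l).Sublist l := by
  induction c generalizing l with
  | nil => exact l.nil_sublist
  | cons b c ih =>
    cases l with
    | nil => exact List.nil_sublist _
    | cons x l =>
      rw [select_cons_cons]
      split_ifs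
      exacts [(ih l).cons_cons x, (ih l).cons x]

end Select

/-- The entries of `l` that are labelled `some b` for some `b` by `c`. The label `none` hides an
entry. -/
def visible {β : Type*} (c : List (Option Bool)) (l : List β) : List β :=
  ((c.zip l).filter fun x => x.1.isSome).map Prod.snd

theorem visible_none_cons {β : Type*} (c : List (Option Bool)) (x : β) (l : List β) :
    visible (none :: c) (x :: l) = visible c l :=
  rfl

theorem visible_some_cons {β : Type*} (b : Bool) (c : List (Option Bool)) (x : β) (l : List β) :
    visible (some b :: c) (x :: l) = x :: visible c l :=
  rfl

theorem select_visible {β : Type*} (b : Bool) (c : List (Option Bool)) (l : List β) :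
    select (some b) (c.reduceOption.map some) (visible c l) = select (some b) c l := by
  induction c generalizing l with
  | nil => rfl
  | cons o c ih =>
    cases l with
    | nil => simp [select, visible]
    | cons x l => cases o <;> simp [visible_none_cons, visible_some_cons, ih]

theorem tendsto_visible (c : List (Option Bool)) :
    Tendsto (visible (β := ℝ) c) (genericList c.length) (genericList c.reduceOption.length) := by
  rw [tendsto_iff_eventually]
  induction c with
  | nil => exact fun _ h => h
  | cons o c ih =>
    intro P h
    rw [List.length_cons, eventually_genericList_succ]
    cases o with
    | none => exact Eventually.of_forall fun _ => ih (p := P) h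
    | some b => exact Eventually.mono h fun x hx => ih hx

/-- Labels showing the sampled letters of a word only. -/
def sampledLabel : Bool → Option Bool
  | true => some true
  | false => none

theorem reduceOption_map_some {β : Type*} (l : List β) : (l.map some).reduceOption = l := by
  simp [List.reduceOption]

theorem reduceOption_map_sampledLabel (t : List Bool) :
    (t.map sampledLabel).reduceOption = List.replicate (t.count true) true := by
  induction t with
  | nil => rfl
  | cons b t ih => cases b <;> simp [sampledLabel, ih, List.replicate_succ]

/-- Labels hiding the last online letter of a word, if there is one. -/
def hideLastFalse : List Bool → List (Option Bool)
  | [] => []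
  | true :: w => some true :: hideLastFalse w
  | false :: w => if false ∈ w then some false :: hideLastFalse w else none :: w.map some

@[simp]
theorem length_hideLastFalse (w : List Bool) : (hideLastFalse w).length = w.length := by
  induction w with
  | nil => rfl
  | cons b w ih =>
    by_cases hw : false ∈ w <;> cases b <;> simp [hideLastFalse, hw, ih]

theorem hideLastFalse_of_notMem {w : List Bool} (hw : false ∉ w) :
    hideLastFalse w = w.map some := by
  induction w with
  | nil => rfl
  | cons b w ih =>
    cases b
    · simp at hw
    · rw [hideLastFalse, ih (by simpa using hw), List.map_cons]

theorem reduceOption_hideLastFalse (w : List Bool) :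
    (hideLastFalse w).reduceOption = dropLastFalse w := by
  induction w with
  | nil => rfl
  | cons b w ih =>
    by_cases hw : false ∈ w <;> cases b <;>
      simp [hideLastFalse, dropLastFalse, hw, ih, reduceOption_map_some]

theorem select_true_hideLastFalse {β : Type*} (w : List Bool) (l : List β) :
    select (some true) (hideLastFalse w) l = select true w l := by
  induction w generalizing l with
  | nil => rfl
  | cons b w ih =>
    cases l with
    | nil => simp [select]
    | cons x l =>
      by_cases hw : false ∈ w <;> cases b <;>
        simp [hideLastFalse, hw, ih, select_map_label (g := some) (a := true)]

theorem select_false_hideLastFalse {β : Type*} {w : List Bool} {l : List β}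
    (h : w.length = l.length) :
    select (some false) (hideLastFalse w) l = (select false w l).dropLast := by
  induction w generalizing l with
  | nil => rfl
  | cons b w ih =>
    obtain ⟨x, l, rfl⟩ := List.exists_cons_of_length_eq_add_one h.symm
    have hl : w.length = l.length := by simpa using h
    by_cases hw : false ∈ w
    · have hne := mt (select_eq_nil_iff hl).1 (not_not_intro hw)
      cases b <;> simp [hideLastFalse, hw, ih hl, List.dropLast_cons_of_ne_nil hne]
    · have hnil := (select_eq_nil_iff hl).2 hw
      cases b
      · simp [hideLastFalse, hw, hnil, select_map_label (g := some) (a := false)]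
      · simp [hideLastFalse, ih hl]

theorem dropLastFalse_replicate_true_append (a : ℕ) (w : List Bool) :
    dropLastFalse (List.replicate a true ++ w) = List.replicate a true ++ dropLastFalse w := by
  induction a with
  | zero => rfl
  | succ a ih => rw [List.replicate_succ, List.cons_append, dropLastFalse, ih, List.cons_append]

/-! ### Ordinal algorithms from arbitrary ones -/

/-- The player rejects all values of the online sequence `vs`. -/
def Rejects (acc : List ℝ → Prop) (vs : List ℝ) : Prop :=
  ∀ s < vs.length, ¬ acc (vs.take (s + 1))

theorem Rejects.dropLast {acc : List ℝ → Prop} {vs : List ℝ} (h : Rejects acc vs) :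
    Rejects acc vs.dropLast := by
  intro s hs
  rw [List.length_dropLast] at hs
  rw [List.dropLast_eq_take, List.take_take, min_eq_left (by omega)]
  exact h s (by omega)

theorem Wins.rejects {acc : List ℝ → Prop} {h l : List ℝ} (hh : h ≠ [])
    (hsorted : h.Pairwise (· < ·)) (hl : ∀ x ∈ l, ∀ y ∈ h, x < y) (hw : Wins acc (h ++ l)) :
    Rejects acc h.dropLast ∧ ¬ Rejects acc h := by
  have hpos : 0 < h.length := List.length_pos_of_ne_nil hh
  obtain ⟨⟨t, ht⟩, ⟨hacc, hnot⟩, hmax⟩ := hw.resolve_left (by simp [hh])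
  simp only [List.get_eq_getElem] at hmax hacc hnot
  have hlast : h[h.length - 1] ≤ (h ++ l)[t] :=
    hmax _ (List.mem_append_left _ (List.getElem_mem _))
  obtain rfl : t = h.length - 1 := by
    rcases lt_trichotomy t (h.length - 1) with hlt | heq | hgt
    · rw [List.getElem_append_left (by omega)] at hlast
      exact absurd (List.pairwise_iff_getElem.1 hsorted _ _ (by omega) (by omega) hlt)
        (not_lt.2 hlast)
    · exact heq
    · rw [List.getElem_append_right (by omega)] at hlast
      exact absurd (hl _ (List.getElem_mem _) _ (List.getElem_mem _)) (not_lt.2 hlast)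
  constructor
  · intro s hs
    rw [List.length_dropLast] at hs
    have := hnot s hs
    rw [List.take_append_of_le_length (by omega)] at this
    rwa [List.dropLast_eq_take, List.take_take, min_eq_left (by omega)]
  · intro hrej
    refine hrej (h.length - 1) (by omega) ?_
    rwa [List.take_append_of_le_length (by omega)] at hacc

theorem measurableSet_rejects (A : Algorithm.{u}) (n : ℕ) (S : Finset ℝ) (vs : List ℝ) :
    MeasurableSet {ω | Rejects (A.accept n ω S) vs} := by
  have : {ω | Rejects (A.accept n ω S) vs} =
      ⋂ s : Fin vs.length, {ω | A.accept n ω S (vs.take (s + 1))}ᶜ := by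
    ext ω
    simp [Rejects, Fin.forall_iff]
  rw [this]
  exact MeasurableSet.iInter fun s => (A.measurableSet_accept n S _).compl

/-- The probability that `A` rejects all values labelled `some false`, when it has sampled those
labelled `some true`. -/
noncomputable def rejectProb (A : Algorithm.{u}) (n : ℕ) (c : List (Option Bool)) (l : List ℝ) :
    ℝ :=
  A.law.real {ω | Rejects (A.accept n ω (select (some true) c l).toFinset)
    (select (some false) c l)}

theorem exists_tendsto_of_mem_Icc {ι : Type*} (F : Ultrafilter ι) {f : ι → ℝ} {a b : ℝ}
    (hf : ∀ i, f i ∈ Set.Icc a b) : ∃ x, Tendsto f F (𝓝 x) := by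
  obtain ⟨x, -, hx⟩ := isCompact_Icc.ultrafilter_le_nhds' (F.map f)
    (Ultrafilter.mem_map.2 (univ_mem' hf))
  exact ⟨x, hx⟩

section GenericRejectProb

variable (A : Algorithm.{u}) (n : ℕ)

theorem rejectProb_mem_Icc (c : List (Option Bool)) (l : List ℝ) :
    rejectProb A n c l ∈ Set.Icc 0 1 :=
  ⟨measureReal_nonneg, measureReal_le_one⟩

theorem rejectProb_visible (c : List (Option Bool)) (l : List ℝ) :
    rejectProb A n (c.reduceOption.map some) (visible c l) = rejectProb A n c l := by
  simp only [rejectProb, select_visible]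

theorem rejectProb_le_hideLastFalse {w : List Bool} {l : List ℝ} (h : w.length = l.length) :
    rejectProb A n (w.map some) l ≤ rejectProb A n (hideLastFalse w) l := by
  simp only [rejectProb, select_map_label (g := some) fun _ => Option.some_inj,
    select_true_hideLastFalse, select_false_hideLastFalse h]
  exact measureReal_mono fun ω hω => Rejects.dropLast hω

/-- The probability that `A` rejects all online values of a generic increasing list, the word `u`
telling which of its values are sampled. -/
noncomputable def genericRejectProb (u : List Bool) : ℝ :=
  limUnder (genericList u.length : Filter (List ℝ)) (rejectProb A n (u.map some))

theorem tendsto_rejectProb (c : List (Option Bool)) :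
    Tendsto (rejectProb A n c) (genericList c.length)
      (𝓝 (genericRejectProb A n c.reduceOption)) := by
  have hlim := tendsto_nhds_limUnder (exists_tendsto_of_mem_Icc
    (genericList c.reduceOption.length) (rejectProb_mem_Icc A n (c.reduceOption.map some)))
  exact (hlim.comp (tendsto_visible c)).congr (rejectProb_visible A n c)

theorem genericRejectProb_mem_Icc (u : List Bool) : genericRejectProb A n u ∈ Set.Icc 0 1 := by
  have hlim := tendsto_rejectProb A n (u.map some)
  rw [reduceOption_map_some] at hlim
  exact isClosed_Icc.mem_of_tendsto hlim (Eventually.of_forall (rejectProb_mem_Icc A n _))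

theorem genericRejectProb_le_dropLastFalse (u : List Bool) :
    genericRejectProb A n u ≤ genericRejectProb A n (dropLastFalse u) := by
  have hall := tendsto_rejectProb A n (u.map some)
  have hhide := tendsto_rejectProb A n (hideLastFalse u)
  rw [reduceOption_map_some, List.length_map] at hall
  rw [reduceOption_hideLastFalse, length_hideLastFalse] at hhide
  refine le_of_tendsto_of_tendsto hall hhide ?_
  filter_upwards [eventually_genericList_length u.length] with l hl
  exact rejectProb_le_hideLastFalse A n hl.symm

/-- To win, the player must reject the large online values except the last one, but not that one.
-/
theorem measureReal_wins_le {t w : List Bool} {l₁ l₂ : List ℝ} (ht : t.length = l₁.length)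
    (hw : w.length = l₂.length) (hsorted : (l₁ ++ l₂).Pairwise (· < ·)) :
    A.law.real {ω | Wins (A.accept n ω (select true (t ++ w) (l₁ ++ l₂)).toFinset)
      (select false w l₂ ++ select false t l₁)} ≤
      rejectProb A n (t.map sampledLabel ++ hideLastFalse w) (l₁ ++ l₂) -
        rejectProb A n (t.map sampledLabel ++ w.map some) (l₁ ++ l₂) +
        if false ∈ w then 0 else 1 := by
  by_cases hfw : false ∈ w
  swap
  · simp [hfw, hideLastFalse_of_notMem hfw]
  have ht' : (t.map sampledLabel).length = l₁.length := by simpa using ht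
  have htrue : select (some true) (t.map sampledLabel) l₁ = select true t l₁ :=
    select_map_label (by simp [sampledLabel]) t l₁
  have hfalse : select (some false) (t.map sampledLabel) l₁ = [] :=
    (select_eq_nil_iff ht').2 (by simp [sampledLabel])
  simp only [rejectProb, select_append _ ht', select_append _ ht, htrue, hfalse, List.nil_append,
    select_map_label (g := some) fun _ => Option.some_inj, select_true_hideLastFalse,
    select_false_hideLastFalse hw, if_pos hfw, add_zero]
  set S := (select true t l₁ ++ select true w l₂).toFinset
  set h := select false w l₂
  have hsub : {ω | Rejects (A.accept n ω S) h} ⊆ {ω | Rejects (A.accept n ω S) h.dropLast} :=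
    fun ω hω => Rejects.dropLast hω
  rw [← measureReal_sdiff hsub (measurableSet_rejects A n S h)]
  obtain ⟨-, hl₂, hlt⟩ := List.pairwise_append.1 hsorted
  exact measureReal_mono fun ω hω => Wins.rejects
    (mt (select_eq_nil_iff hw).1 (not_not_intro hfw)) (hl₂.sublist (select_sublist _ _ _))
    (fun x hx y hy => hlt x ((select_sublist _ _ _).subset hx) y
      ((select_sublist _ _ _).subset hy)) hω

end GenericRejectProb

theorem exists_perm_ofFn_eq {n : ℕ} {L : List (Fin n)} (hnodup : L.Nodup) (hlen : L.length = n) :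
    ∃ σ : Equiv.Perm (Fin n), List.ofFn σ = L := by
  have hinj : Function.Injective fun i : Fin n => L.get (i.cast hlen.symm) :=
    (List.nodup_iff_injective_get.1 hnodup).comp (Fin.cast_injective _)
  refine ⟨Equiv.ofBijective _ (Finite.injective_iff_bijective.1 hinj), ?_⟩
  exact List.ext_getElem (by simp [hlen]) (by simp)

/-- The instance has the values `l`; its first `T` values arrive last, and the others arrive first
in the order of `l`. -/
theorem exists_winProb_eq_wordExp (p : ℝ) (A : Algorithm.{u}) {n : ℕ} (T : ℕ) {l : List ℝ}
    (hlen : l.length = n) (hnodup : l.Nodup) :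
    ∃ (α : Fin n ↪ ℝ) (σ : Equiv.Perm (Fin n)), winProb p A α (fun _ => σ) =
      wordExp p n fun W => A.law.real {ω | Wins (A.accept n ω (select true W l).toFinset)
        (select false (W.drop T) (l.drop T) ++ select false (W.take T) (l.take T))} := by
  subst hlen
  let α : Fin l.length ↪ ℝ := ⟨l.get, List.nodup_iff_injective_get.1 hnodup⟩
  have hα : l = (List.finRange l.length).map α := List.ext_getElem (by simp) (by simp [α])
  set L := List.finRange l.length
  obtain ⟨σ, hσ⟩ := exists_perm_ofFn_eq (L := L.drop T ++ L.take T)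
    (List.nodup_append_comm.1 (by rw [List.take_append_drop]; exact List.nodup_finRange _))
    (by rw [List.length_append, add_comm, ← List.length_append, List.take_append_drop,
      List.length_finRange])
  refine ⟨α, σ, ?_⟩
  rw [← sum_finset_eq_wordExp p 1, winProb]
  refine Finset.sum_congr rfl fun S _ => ?_
  have hword : (List.ofFn fun i => decide ((1 : Equiv.Perm (Fin l.length)) i ∈ S)) =
      L.map fun i => decide (i ∈ S) := List.ofFn_eq_map
  have hsampled : S.map α = (select true (L.map fun i => decide (i ∈ S)) (L.map α)).toFinset := by
    rw [select_map_map]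
    ext x
    simp [L]
  have honline : onlineValues α σ S =
      select false ((L.map fun i => decide (i ∈ S)).drop T) ((L.map α).drop T) ++
        select false ((L.map fun i => decide (i ∈ S)).take T) ((L.map α).take T) := by
    rw [onlineValues, hσ, ← List.map_drop, ← List.map_take, ← List.map_drop, ← List.map_take,
      select_map_map, select_map_map, List.filter_append, List.map_append]
    simp
  rw [hword, hsampled, honline, ← hα]

/-! ### The limiting ordinal algorithm -/

section LimitRejectProb

variable {p : ℝ} (A : Algorithm.{u})

theorem winProb_nonneg (hp0 : 0 ≤ p) (hp1 : p ≤ 1) {n : ℕ} (α : Fin n ↪ ℝ)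
    (σ : Finset (Fin n) → Equiv.Perm (Fin n)) : 0 ≤ winProb p A α σ := by
  have : 0 ≤ 1 - p := sub_nonneg.2 hp1
  exact Finset.sum_nonneg fun S _ => by positivity

theorem obliviousSuccessProb_nonneg (hp0 : 0 ≤ p) (hp1 : p ≤ 1) (n : ℕ) :
    0 ≤ obliviousSuccessProb p A n :=
  Real.iInf_nonneg fun _ => winProb_nonneg A hp0 hp1 _ _

theorem obliviousGuarantee_le_winProb (hp0 : 0 ≤ p) (hp1 : p ≤ 1) {n : ℕ} (α : Fin n ↪ ℝ)
    (σ : Equiv.Perm (Fin n)) : obliviousGuarantee p A ≤ winProb p A α fun _ => σ :=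
  (ciInf_le ⟨0, Set.forall_mem_range.2 (obliviousSuccessProb_nonneg A hp0 hp1)⟩ n).trans
    (ciInf_le ⟨0, Set.forall_mem_range.2 fun _ => winProb_nonneg A hp0 hp1 _ _⟩ (α, σ))

theorem eventually_obliviousGuarantee_le (hp0 : 0 ≤ p) (hp1 : p ≤ 1) (T M : ℕ) :
    ∀ᶠ l in genericList (T + M), obliviousGuarantee p A ≤
      wordExp p T fun t => wordExp p M fun w =>
        rejectProb A (T + M) (t.map sampledLabel ++ hideLastFalse w) l -
          rejectProb A (T + M) (t.map sampledLabel ++ w.map some) l +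
          if false ∈ w then 0 else 1 := by
  filter_upwards [eventually_genericList_length (T + M), eventually_genericList_sorted (T + M)]
    with l hlen hsorted
  obtain ⟨α, σ, hασ⟩ := exists_winProb_eq_wordExp p A T hlen (hsorted.imp ne_of_lt)
  refine (obliviousGuarantee_le_winProb A hp0 hp1 α σ).trans ?_
  rw [hασ, wordExp_append]
  refine wordExp_mono hp0 hp1 fun t ht => wordExp_mono hp0 hp1 fun w hw => ?_
  have hwins := measureReal_wins_le A (T + M) (t := t) (w := w) (l₁ := l.take T) (l₂ := l.drop T)
    (by simp [ht, hlen]) (by simp [hw, hlen]) (by rwa [List.take_append_drop])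
  rw [List.take_append_drop] at hwins
  simpa [← ht] using hwins

theorem obliviousGuarantee_le_wordExp_genericRejectProb (hp0 : 0 ≤ p) (hp1 : p ≤ 1) (T M : ℕ) :
    obliviousGuarantee p A ≤ wordExp p T fun t => wordExp p M fun w =>
      stopGain (fun u => genericRejectProb A (T + M) (List.replicate (t.count true) true ++ u)) w +
        if false ∈ w then 0 else 1 := by
  have hlim {t w : List Bool} (ht : t.length = T) (hw : w.length = M) {c : List (Option Bool)}
      (hc : c.length = w.length) : Tendsto (rejectProb A (T + M) (t.map sampledLabel ++ c))
        (genericList (T + M)) (𝓝 (genericRejectProb A (T + M)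
          (List.replicate (t.count true) true ++ c.reduceOption))) := by
    have := tendsto_rejectProb A (T + M) (t.map sampledLabel ++ c)
    rwa [List.reduceOption_append, reduceOption_map_sampledLabel, List.length_append,
      List.length_map, ht, hc, hw] at this
  refine ge_of_tendsto (tendsto_wordExp fun t ht => tendsto_wordExp fun w hw => ?_)
    (eventually_obliviousGuarantee_le A hp0 hp1 T M)
  have hhide := hlim ht hw (length_hideLastFalse w)
  have hall := hlim ht hw (c := w.map some) (List.length_map _)
  rw [reduceOption_hideLastFalse] at hhide
  rw [reduceOption_map_some] at hall
  exact (hhide.sub hall).add_const _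

/-- The probability that `A` rejects all online values when `T` generic small values are sampled
with probability `p`, those which are not sampled are hidden, and `u` tells which of the larger
values are sampled. -/
noncomputable def averagedRejectProb (p : ℝ) (n T : ℕ) (u : List Bool) : ℝ :=
  binomExp p T fun a => genericRejectProb A n (List.replicate a true ++ u)

theorem averagedRejectProb_mem_Icc (hp0 : 0 ≤ p) (hp1 : p ≤ 1) (n T : ℕ) (u : List Bool) :
    averagedRejectProb A p n T u ∈ Set.Icc 0 1 :=
  wordExp_mem_Icc hp0 hp1 fun t =>
    genericRejectProb_mem_Icc A n (List.replicate (t.count true) true ++ u)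

theorem averagedRejectProb_le_dropLastFalse (hp0 : 0 ≤ p) (hp1 : p ≤ 1) (n T : ℕ)
    (u : List Bool) :
    averagedRejectProb A p n T u ≤ averagedRejectProb A p n T (dropLastFalse u) := by
  simp only [averagedRejectProb, binomExp]
  refine wordExp_mono hp0 hp1 fun t _ => ?_
  rw [← dropLastFalse_replicate_true_append]
  exact genericRejectProb_le_dropLastFalse A n _

theorem obliviousGuarantee_le_wordExp_averagedRejectProb (hp0 : 0 ≤ p) (hp1 : p ≤ 1) (T M : ℕ) :
    obliviousGuarantee p A ≤
      wordExp p M (stopGain (averagedRejectProb A p (T + M) T)) + p ^ M := by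
  refine (obliviousGuarantee_le_wordExp_genericRejectProb A hp0 hp1 T M).trans_eq ?_
  rw [wordExp_comm, ← mul_one (p ^ M), ← wordExp_ite_false_mem p M fun _ => 1, ← wordExp_add]
  refine wordExp_congr fun w _ => ?_
  rw [wordExp_add, wordExp_const]
  exact congrArg (· + _) (wordExp_sub ..)

/-- The limit of `averagedRejectProb` along an ultrafilter. Unlike `A` it does not depend on a
number of elements. -/
noncomputable def limitRejectProb (p : ℝ) (u : List Bool) : ℝ :=
  limUnder (hyperfilter ℕ : Filter ℕ) fun n => averagedRejectProb A p n n u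

theorem tendsto_averagedRejectProb (hp0 : 0 ≤ p) (hp1 : p ≤ 1) (u : List Bool) :
    Tendsto (fun n => averagedRejectProb A p n n u) (hyperfilter ℕ)
      (𝓝 (limitRejectProb A p u)) :=
  tendsto_nhds_limUnder (exists_tendsto_of_mem_Icc _ fun n =>
    averagedRejectProb_mem_Icc A hp0 hp1 n n u)

theorem limitRejectProb_mem_Icc (hp0 : 0 ≤ p) (hp1 : p ≤ 1) (u : List Bool) :
    limitRejectProb A p u ∈ Set.Icc 0 1 :=
  isClosed_Icc.mem_of_tendsto (tendsto_averagedRejectProb A hp0 hp1 u)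
    (Eventually.of_forall fun n => averagedRejectProb_mem_Icc A hp0 hp1 n n u)

theorem limitRejectProb_le_dropLastFalse (hp0 : 0 ≤ p) (hp1 : p ≤ 1) (u : List Bool) :
    limitRejectProb A p u ≤ limitRejectProb A p (dropLastFalse u) :=
  le_of_tendsto_of_tendsto' (tendsto_averagedRejectProb A hp0 hp1 _)
    (tendsto_averagedRejectProb A hp0 hp1 _) fun n =>
      averagedRejectProb_le_dropLastFalse A hp0 hp1 n n u

theorem obliviousGuarantee_le_wordExp_limitRejectProb (hp0 : 0 ≤ p) (hp1 : p < 1) (M : ℕ) :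
    obliviousGuarantee p A ≤ wordExp p M (stopGain (limitRejectProb A p)) + p ^ M := by
  have hlim (u : List Bool) : Tendsto (fun n => averagedRejectProb A p n (n - M) u) (hyperfilter ℕ)
      (𝓝 (limitRejectProb A p u)) := by
    have hsub := (tendsto_binomExp_sub hp0 hp1 M fun n a =>
      genericRejectProb_mem_Icc A n (List.replicate a true ++ u)).mono_left
        Nat.hyperfilter_le_atTop
    simpa [averagedRejectProb] using hsub.add (tendsto_averagedRejectProb A hp0 hp1.le u)
  refine ge_of_tendsto
    ((tendsto_wordExp fun w _ => (hlim (dropLastFalse w)).sub (hlim w)).add_const (p ^ M)) ?_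
  filter_upwards [Nat.hyperfilter_le_atTop (eventually_ge_atTop M)] with n hn
  have := obliviousGuarantee_le_wordExp_averagedRejectProb A hp0 hp1.le (n - M) M
  rwa [Nat.sub_add_cancel hn] at this

theorem obliviousGuarantee_le (hp0 : 0 ≤ p) (hp1 : p < 1) {k : ℕ} (hkp : k * (1 - p) ≤ 1)
    (hkp' : 1 < (k + 1) * (1 - p)) : obliviousGuarantee p A ≤ k * p ^ k * (1 - p) :=
  le_of_forall_le_wordExp_stopGain hp0 hp1 hkp hkp' (limitRejectProb_mem_Icc A hp0 hp1.le)
    (limitRejectProb_le_dropLastFalse A hp0 hp1.le)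
    (obliviousGuarantee_le_wordExp_limitRejectProb A hp0 hp1)

end LimitRejectProb

/-! ### Success guarantees -/

section Guarantee

variable {p : ℝ}

theorem successProb_nonneg (A : Algorithm.{u}) (hp0 : 0 ≤ p) (hp1 : p ≤ 1) (n : ℕ) :
    0 ≤ successProb p A n :=
  Real.iInf_nonneg fun _ => winProb_nonneg A hp0 hp1 _ _

theorem successProb_le_winProb (A : Algorithm.{u}) (hp0 : 0 ≤ p) (hp1 : p ≤ 1) {n : ℕ}
    (α : Fin n ↪ ℝ) (σ : Finset (Fin n) → Equiv.Perm (Fin n)) :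
    successProb p A n ≤ winProb p A α σ :=
  ciInf_le ⟨0, Set.forall_mem_range.2 fun _ => winProb_nonneg A hp0 hp1 _ _⟩ (α, σ)

/-- The increasing values `0, 1, …, n - 1`, a worst case for the `k`-max algorithm. -/
noncomputable def natValues (n : ℕ) : Fin n ↪ ℝ :=
  Fin.valEmbedding.trans Nat.castEmbedding

theorem strictMono_natValues (n : ℕ) : StrictMono (natValues n) := fun _ _ h =>
  Nat.cast_lt.2 h

instance nonempty_values (n : ℕ) : Nonempty (Fin n ↪ ℝ) :=
  ⟨natValues n⟩

theorem guarantee_le_obliviousGuarantee (A : Algorithm.{u}) (hp0 : 0 ≤ p) (hp1 : p ≤ 1) :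
    guarantee p A ≤ obliviousGuarantee p A :=
  le_ciInf fun n => le_ciInf fun x =>
    (ciInf_le ⟨0, Set.forall_mem_range.2 (successProb_nonneg A hp0 hp1)⟩ n).trans
      (successProb_le_winProb A hp0 hp1 x.1 fun _ => x.2)

theorem kMax_bound_le_guarantee (hp0 : 0 ≤ p) (hp1 : p ≤ 1) {k : ℕ} (hk : 1 ≤ k) :
    k * p ^ k * (1 - p) ≤ guarantee p (kMax k) :=
  le_ciInf fun _ => le_ciInf fun x => kMax_bound_le_winProb hp0 hp1 hk x.1 x.2

theorem successProb_kMax (hp0 : 0 ≤ p) (hp1 : p ≤ 1) {k : ℕ} (hk : 1 ≤ k) (n : ℕ) :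
    successProb p (kMax k) n = (min k n : ℕ) * p ^ min k (n - 1) * (1 - p) + p ^ n :=
  le_antisymm ((successProb_le_winProb _ hp0 hp1 (natValues n) fun _ => 1).trans_eq
      (winProb_kMax_of_strictMono hk (strictMono_natValues n)))
    (le_ciInf fun x => le_winProb_kMax hp0 hp1 hk x.1 x.2)

end Guarantee

end AOS

theorem mainTheorem1 (p : ℝ) (hp0 : 0 ≤ p) (hp1 : p < 1) (k : ℕ)
    (hk : k = ⌊1 / (1 - p)⌋₊) :
    (∀ (n : ℕ) (α : Fin n ↪ ℝ) (σ : Finset (Fin n) → Equiv.Perm (Fin n)),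
      k * p ^ k * (1 - p) ≤ AOS.winProb p (AOS.kMax k) α σ) ∧
    (∀ n : ℕ, k < n → AOS.successProb p (AOS.kMax k) n = k * p ^ k * (1 - p) + p ^ n) ∧
    AOS.guarantee p (AOS.kMax k) = k * p ^ k * (1 - p) ∧
    AOS.obliviousGuarantee p (AOS.kMax k) = k * p ^ k * (1 - p) ∧
    (∀ A : AOS.Algorithm.{u}, AOS.guarantee p A ≤ k * p ^ k * (1 - p)) ∧
    (∀ A : AOS.Algorithm.{u}, AOS.obliviousGuarantee p A ≤ k * p ^ k * (1 - p)) := by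
  have hp : 0 < 1 - p := sub_pos.2 hp1
  have hk1 : 1 ≤ k := by
    rw [hk, Nat.one_le_floor_iff, one_le_div₀ hp]
    exact sub_le_self 1 hp0
  have hkp : k * (1 - p) ≤ 1 := by
    rw [← le_div_iff₀ hp, hk]
    exact Nat.floor_le (by positivity)
  have hkp' : 1 < ((k : ℝ) + 1) * (1 - p) := by
    rw [← div_lt_iff₀ hp, hk]
    exact Nat.lt_floor_add_one _
  have hkMax := AOS.kMax_bound_le_guarantee hp0 hp1.le hk1
  have hknown := AOS.guarantee_le_obliviousGuarantee (AOS.kMax k) hp0 hp1.le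
  have hoptimal := AOS.obliviousGuarantee_le (AOS.kMax k) hp0 hp1 hkp hkp'
  refine ⟨fun n α σ => AOS.kMax_bound_le_winProb hp0 hp1.le hk1 α σ, fun n hn => ?_,
    (hknown.trans hoptimal).antisymm hkMax, hoptimal.antisymm (hkMax.trans hknown),
    fun A => (AOS.guarantee_le_obliviousGuarantee A hp0 hp1.le).trans
      (AOS.obliviousGuarantee_le A hp0 hp1 hkp hkp'),
    fun A => AOS.obliviousGuarantee_le A hp0 hp1 hkp hkp'⟩
  rw [AOS.successProb_kMax hp0 hp1.le hk1, min_eq_left hn.le, min_eq_left (Nat.le_sub_one_of_lt hn)]
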